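/- Let $D=(E,\mathcal F)$ be a delta-matroid, that is, $E$ is a finite set and $\mathcal F$ is a non-empty collection of subsets of $E$ (the feasible sets) such that for all $X,Y\in\mathcal F$ and all $u\in X\bigtriangleup Y$ there is a $v\in X\bigtriangleup Y$ (possibly $v=u$) with $X\bigtriangleup\{u,v\}\in\mathcal F$. Let $\prec$ be a total ordering of $E$. For $X\subseteq E$ put $d(X):=\min_{F\in\mathcal F}|F\bigtriangleup X|$, and let \[ Q(D;w,x,t):=\sum_{A\subseteq E} w^{|E-A|}x^{|A|}t^{d(A)}\in\mathbb Z[w,x,t] \] be the transition polynomial of $D$. Let $F\in\mathcal F$ and $e\in E$. Call $e$ $F$-orientable if $F\bigtriangleup\{e\}\notin\mathcal F$. If $e$ is $F$-orientable and $f\in E$ with $f\neq e$, call $e$ $F$-interlaced with $f$ if $F\bigtriangleup\{e,f\}\in\mathcal F$. Call $e$ active with respect to $F$ if $e$ is $F$-orientable and there is no $f\prec e$ such that $e$ is $F$-interlaced with $f$. Let $\mathrm{int}_\prec(F)$ be the set of active elements with respect to $F$ that belong to $F$ (the internally active elements), and $\mathrm{ext}_\prec(F)$ the set of active elements with respect to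 $F$ that do not belong to $F$ (the externally active elements). Then \[ Q(D;w,x,t)=\sum_{F\in\mathcal F} w^{|E|-|F|}\,x^{|F|}\,\bigl(1+(w/x)t\bigr)^{|\mathrm{int}_\prec(F)|}\bigl(1+(x/w)t\bigr)^{|\mathrm{ext}_\prec(F)|}, \] as an identity of rational functions in the indeterminates $w,x,t$ and, more generally, for all units $w,x$ and all elements $t$ of an arbitrary commutative ring. -/

import Mathlib

/-- A delta-matroid on the finite set `E`: a non-empty collection of subsets of `E`, the feasible
sets, satisfying the symmetric exchange axiom (in which `v = u` is allowed). -/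
structure DeltaMatroid (E : Type*) [DecidableEq E] where
  /-- The collection of feasible sets. -/
  feasible : Finset (Finset E)
  feasible_nonempty : feasible.Nonempty
  symmetric_exchange : ∀ X ∈ feasible, ∀ Y ∈ feasible, ∀ u ∈ symmDiff X Y,
    ∃ v ∈ symmDiff X Y, symmDiff X {u, v} ∈ feasible

namespace DeltaMatroid

section Basic

variable {E : Type*} [DecidableEq E] (D : DeltaMatroid E)

/-- The distance `d(X) = min_{F feasible} |F △ X|` from `X` to the feasible sets. -/
def dist (X : Finset E) : ℕ :=
  D.feasible.inf' D.feasible_nonempty fun F => (symmDiff F X).card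

/-- The transition polynomial `Q(D; w, x, t) = ∑_{A ⊆ E} w ^ |E - A| x ^ |A| t ^ d(A)`, as a
polynomial with integer coefficients in the three indeterminates `w = X 0`, `x = X 1`,
`t = X 2`. -/
noncomputable def transitionPolynomial [Fintype E] : MvPolynomial (Fin 3) ℤ :=
  ∑ A : Finset E, MvPolynomial.X 0 ^ (Aᶜ).card * MvPolynomial.X 1 ^ A.card *
    MvPolynomial.X 2 ^ D.dist A

/-- `e` is `F`-orientable: `F △ {e}` is not feasible. -/
def IsOrientable (F : Finset E) (e : E) : Prop :=
  symmDiff F {e} ∉ D.feasible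

/-- `e` is `F`-interlaced with `f`: `e` and `f` are distinct, `e` is `F`-orientable, and
`F △ {e, f}` is feasible. -/
def IsInterlaced (F : Finset E) (e f : E) : Prop :=
  e ≠ f ∧ D.IsOrientable F e ∧ symmDiff F {e, f} ∈ D.feasible

end Basic

section Activity

variable {E : Type*} [LinearOrder E] (D : DeltaMatroid E)

/-- `e` is active with respect to `F`: it is `F`-orientable and not `F`-interlaced with any
smaller element. -/
def IsActive (F : Finset E) (e : E) : Prop :=
  D.IsOrientable F e ∧ ∀ f, f < e → ¬ D.IsInterlaced F e f

open Classical in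
/-- The set `int(F)` of internally active elements: the active elements belonging to `F`. -/
noncomputable def internallyActive [Fintype E] (F : Finset E) : Finset E :=
  Finset.univ.filter fun e => D.IsActive F e ∧ e ∈ F

open Classical in
/-- The set `ext(F)` of externally active elements: the active elements not belonging to `F`. -/
noncomputable def externallyActive [Fintype E] (F : Finset E) : Finset E :=
  Finset.univ.filter fun e => D.IsActive F e ∧ e ∉ F

end Activity

end DeltaMatroid

namespace DeltaMatroid

/-! ### Distances, and restriction to the feasible sets with prescribed behaviour at one element. -/

section Distance

variable {E : Type*} [DecidableEq E] (D : DeltaMatroid E)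

/-! Split on the largest element `e`. If some feasible sets contain `e` and others avoid it,
exchange at `e` shows that `e` is never active and that each distance is attained by a feasible set
agreeing at `e`; both sides then split over the two `agreeing` delta-matroids. If all feasible sets
agree at `e`, then `e` is always active, and pairing `A` with `A △ {e}` yields the factor `1 +
toggle * t`. Instead of shrinking the ground set, the induction in
`sum_powerset_eq_sum_activityTerm` freezes the feasible sets to a common trace `B` outside `U`. -/

theorem le_dist_iff {X : Finset E} {n : ℕ} :
    n ≤ D.dist X ↔ ∀ F ∈ D.feasible, n ≤ (symmDiff F X).card := by
  simp [dist]

theorem dist_le {X F : Finset E} (hF : F ∈ D.feasible) : D.dist X ≤ (symmDiff F X).card :=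
  D.le_dist_iff.1 le_rfl F hF

/-- If all feasible sets differ from `A` at `e`, changing `A` at `e` lowers the distance by one. -/
theorem dist_eq_succ_of_forall_mem_symmDiff {A A' : Finset E} {e : E}
    (hA : symmDiff A {e} = A') (h : ∀ F ∈ D.feasible, e ∈ symmDiff F A) :
    D.dist A = D.dist A' + 1 := by
  have key : ∀ F ∈ D.feasible, (symmDiff F A).card = (symmDiff F A').card + 1 := by
    intro F hF
    have h1 : symmDiff F A' = (symmDiff F A).erase e := by
      have := h F hF
      subst hA
      ext z
      by_cases hz : z = e
      · subst hz; simp only [Finset.mem_symmDiff, Finset.mem_erase, Finset.mem_singleton] at *; tauto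
      · simp [Finset.mem_symmDiff, hz]
    rw [h1, Finset.card_erase_add_one (h F hF)]
  apply le_antisymm
  · obtain ⟨F, hF, hFA⟩ := D.feasible.exists_mem_eq_inf' D.feasible_nonempty
      fun F => (symmDiff F A').card
    have : D.dist A' = (symmDiff F A').card := hFA
    rw [this, ← key F hF]
    exact D.dist_le hF
  · rw [le_dist_iff]
    intro F hF
    rw [key F hF]
    exact Nat.succ_le_succ (D.dist_le hF)

/-- The delta-matroid of the feasible sets that agree with the feasible set `F₀` at `e`. -/
def agreeing (e : E) (F₀ : Finset E) (h₀ : F₀ ∈ D.feasible) : DeltaMatroid E where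
  feasible := D.feasible.filter fun F => e ∈ F ↔ e ∈ F₀
  feasible_nonempty := ⟨F₀, by simp [h₀]⟩
  symmetric_exchange := by
    intro X hX Y hY u hu
    rw [Finset.mem_filter] at hX hY
    obtain ⟨v, hv, hXv⟩ := D.symmetric_exchange X hX.1 Y hY.1 u hu
    refine ⟨v, hv, Finset.mem_filter.2 ⟨hXv, ?_⟩⟩
    -- Both `u` and `v` lie in `X △ Y`, which misses `e`, so the exchange leaves `e` untouched.
    have he : e ∉ symmDiff X Y := by
      rw [Finset.mem_symmDiff]; tauto
    have hu' : e ≠ u := fun h => he (h ▸ hu)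
    have hv' : e ≠ v := fun h => he (h ▸ hv)
    simp [Finset.mem_symmDiff, hu', hv', hX.2]

theorem mem_agreeing {e : E} {F₀ F : Finset E} {h₀ : F₀ ∈ D.feasible} :
    F ∈ (D.agreeing e F₀ h₀).feasible ↔ F ∈ D.feasible ∧ (e ∈ F ↔ e ∈ F₀) := by
  simp [agreeing]

/-- The distance of `A` is attained by a feasible set that agrees with `A` at `e`, if any
feasible set does. -/
theorem dist_agreeing {e : E} {F₀ A : Finset E} (h₀ : F₀ ∈ D.feasible) (hA : e ∈ A ↔ e ∈ F₀) :
    (D.agreeing e F₀ h₀).dist A = D.dist A := by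
  apply le_antisymm
  · rw [le_dist_iff]
    intro F hF
    by_cases hFe : e ∈ F ↔ e ∈ F₀
    · exact dist_le _ (D.mem_agreeing.2 ⟨hF, hFe⟩)
    have heF : e ∈ symmDiff F F₀ := by rw [Finset.mem_symmDiff]; tauto
    have heA : e ∈ symmDiff F A := by rw [Finset.mem_symmDiff]; tauto
    -- Exchanging towards `F₀` repairs the disagreement with `A` at `e`, gaining one, and `v` costs
    -- at most one.
    obtain ⟨v, -, hv⟩ := D.symmetric_exchange F hF F₀ h₀ e heF
    have hmem : symmDiff F {e, v} ∈ (D.agreeing e F₀ h₀).feasible := by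
      refine D.mem_agreeing.2 ⟨hv, ?_⟩
      simp only [Finset.mem_symmDiff, Finset.mem_insert, true_or, not_true, and_false, false_or,
        true_and]
      tauto
    refine (dist_le _ hmem).trans ?_
    have hsub : symmDiff (symmDiff F {e, v}) A ⊆ insert v ((symmDiff F A).erase e) := by
      intro z
      by_cases hz : z = v
      · simp [hz]
      by_cases hze : z = e
      · subst hze
        simp only [Finset.mem_symmDiff, Finset.mem_insert, Finset.mem_erase] at *
        tauto
      · simp [Finset.mem_symmDiff, hz, hze]
    calc _ ≤ _ := Finset.card_le_card hsub
      _ ≤ _ := Finset.card_insert_le _ _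
      _ = _ := Finset.card_erase_add_one heA
  · rw [le_dist_iff]
    exact fun F hF => D.dist_le (D.mem_agreeing.1 hF).1

end Distance

/-! ### Activities, weights and the induction on the largest element. -/

section Expansion

variable {E : Type*} [LinearOrder E] (D : DeltaMatroid E)

/-- Activity of `f` only tests changes at elements up to `f`, hence below `e`. -/
theorem isActive_agreeing_iff {e f : E} {F₀ F : Finset E} {h₀ : F₀ ∈ D.feasible}
    (hF : e ∈ F ↔ e ∈ F₀) (hf : f < e) :
    (D.agreeing e F₀ h₀).IsActive F f ↔ D.IsActive F f := by
  have h1 : (D.agreeing e F₀ h₀).IsOrientable F f ↔ D.IsOrientable F f := by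
    simp [IsOrientable, mem_agreeing, Finset.mem_symmDiff, hf.ne', hF]
  refine and_congr h1 (forall₂_congr fun g hg => not_congr ?_)
  have hge : e ≠ g := (hg.trans hf).ne'
  refine and_congr Iff.rfl (and_congr h1 ?_)
  simp [mem_agreeing, Finset.mem_symmDiff, hf.ne', hge, hF]

/-- Changing `F` at `e`, alone or with another element, can never give a feasible set. -/
theorem isActive_of_forall_agree {e : E} {F : Finset E}
    (h : ∀ G ∈ D.feasible, (e ∈ G ↔ e ∈ F)) : D.IsActive F e := by
  constructor
  · intro h'
    simpa [Finset.mem_symmDiff] using h _ h'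
  · rintro f - ⟨-, -, h'⟩
    simpa [Finset.mem_symmDiff] using h _ h'

/-- Exchange at `e` yields some `v ≤ e`: `v = e` contradicts orientability, `v < e` gives an
interlacing. -/
theorem not_isActive_of_forall_symmDiff_le {e : E} {F G : Finset E} (hF : F ∈ D.feasible)
    (hG : G ∈ D.feasible) (he : e ∈ symmDiff F G) (h : ∀ v ∈ symmDiff F G, v ≤ e) :
    ¬ D.IsActive F e := by
  rintro ⟨h1, h2⟩
  obtain ⟨v, hv, hFv⟩ := D.symmetric_exchange F hF G hG e he
  rcases (h v hv).eq_or_lt with rfl | hlt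
  · exact h1 (by simpa using hFv)
  · exact h2 v hlt ⟨hlt.ne', h1, hFv⟩

variable {R : Type*} [CommRing R] (w x : Rˣ) (t : R)

/-- The weight `w ^ |E - A| x ^ |A|` of a set. -/
def weight [Fintype E] (A : Finset E) : R :=
  (w : R) ^ (Fintype.card E - A.card) * (x : R) ^ A.card

/-- The factor by which the weight of `A` changes when `A` is changed at `e`. -/
def toggle (A : Finset E) (e : E) : R :=
  if e ∈ A then ((w / x : Rˣ) : R) else ((x / w : Rˣ) : R)

theorem weight_insert [Fintype E] {A : Finset E} {e : E} (he : e ∉ A) :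
    weight w x (insert e A) = ((x / w : Rˣ) : R) * weight w x A := by
  have hle : (insert e A).card ≤ Fintype.card E := Finset.card_le_univ _
  rw [Finset.card_insert_of_notMem he] at hle
  -- `k` elements lie outside `insert e A`; naming it removes the truncated subtractions.
  obtain ⟨k, hk⟩ := Nat.exists_eq_add_of_le hle
  have h1 : Fintype.card E - (A.card + 1) = k := by omega
  have h2 : Fintype.card E - A.card = k + 1 := by omega
  rw [weight, weight, Finset.card_insert_of_notMem he, h1, h2]
  norm_cast
  rw [div_mul_eq_mul_div, eq_div_iff_mul_eq']
  simp only [pow_succ]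
  ac_rfl

theorem weight_eq_mul_weight_insert [Fintype E] {A : Finset E} {e : E} (he : e ∉ A) :
    weight w x A = ((w / x : Rˣ) : R) * weight w x (insert e A) := by
  rw [weight_insert w x he, ← mul_assoc, ← Units.val_mul]
  simp

open Classical in
/-- The term of the activities expansion at `F`, with only the active elements in `U` counted. -/
noncomputable def activityTerm [Fintype E] (U F : Finset E) : R :=
  weight w x F * ∏ e ∈ U, if D.IsActive F e then 1 + toggle w x F e * t else 1

theorem activityTerm_insert_of_isActive [Fintype E] {U F : Finset E} {e : E} (he : e ∉ U)
    (h : D.IsActive F e) :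
    D.activityTerm w x t (insert e U) F =
      (1 + toggle w x F e * t) * D.activityTerm w x t U F := by
  simp only [activityTerm, Finset.prod_insert he, if_pos h]
  ring

theorem activityTerm_insert_of_not_isActive [Fintype E] {U F : Finset E} {e : E} (he : e ∉ U)
    (h : ¬ D.IsActive F e) :
    D.activityTerm w x t (insert e U) F = D.activityTerm w x t U F := by
  simp only [activityTerm, Finset.prod_insert he, if_neg h, one_mul]

theorem activityTerm_agreeing [Fintype E] {U F F₀ : Finset E} {e : E} {h₀ : F₀ ∈ D.feasible}
    (hF : e ∈ F ↔ e ∈ F₀) (hU : ∀ f ∈ U, f < e) :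
    (D.agreeing e F₀ h₀).activityTerm w x t U F = D.activityTerm w x t U F := by
  classical
  unfold activityTerm
  congr 1
  refine Finset.prod_congr rfl fun f hf => ?_
  simp only [D.isActive_agreeing_iff hF (hU f hf)]

/-- The activities expansion for a delta-matroid whose feasible sets all agree with `B`
outside `U`. -/
theorem sum_powerset_eq_sum_activityTerm [Fintype E] (U : Finset E) :
    ∀ (D : DeltaMatroid E) (B : Finset E), Disjoint B U → (∀ F ∈ D.feasible, F \ U = B) →
      ∑ S ∈ U.powerset, weight w x (B ∪ S) * t ^ D.dist (B ∪ S) =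
        ∑ F ∈ D.feasible, D.activityTerm w x t U F := by
  induction U using Finset.induction_on_max with
  | empty =>
    intro D B _ hB
    have hD : D.feasible = {B} := by
      obtain ⟨F, hF⟩ := D.feasible_nonempty
      refine Finset.eq_singleton_iff_unique_mem.2 ⟨?_, fun G hG => by simpa using hB G hG⟩
      have := hB F hF
      rw [Finset.sdiff_empty] at this
      exact this ▸ hF
    simp [hD, activityTerm, dist]
  | insert e U hU ih =>
    intro D B hBU hB
    have heU : e ∉ U := fun h => lt_irrefl e (hU e h)
    rw [Finset.disjoint_insert_right] at hBU
    obtain ⟨heB, hBU⟩ := hBU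
    have hBU' : Disjoint (insert e B) U := by
      rw [Finset.disjoint_insert_left]; exact ⟨heU, hBU⟩
    have hout : ∀ F ∈ D.feasible, e ∉ F → F \ U = B := by
      intro F hF h
      rw [← hB F hF, Finset.sdiff_insert, Finset.erase_eq_of_notMem]
      simp [h]
    have hin : ∀ F ∈ D.feasible, e ∈ F → F \ U = insert e B := by
      intro F hF h
      rw [← hB F hF, Finset.sdiff_insert, Finset.insert_erase]
      simp [h, heU]
    have heS : ∀ S ∈ U.powerset, e ∉ B ∪ S := by
      intro S hS h
      rcases Finset.mem_union.1 h with h | h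
      · exact heB h
      · exact heU (Finset.mem_powerset.1 hS h)
    rw [Finset.sum_powerset_insert heU]
    simp only [Finset.union_insert]
    by_cases h1 : ∃ F ∈ D.feasible, e ∈ F
    · by_cases h0 : ∃ F ∈ D.feasible, e ∉ F
      · obtain ⟨F₁, hF₁, he₁⟩ := h1
        obtain ⟨F₀, hF₀, he₀⟩ := h0
        have ih0 := ih (D.agreeing e F₀ hF₀) B hBU fun F hF => by
          rw [mem_agreeing] at hF
          exact hout F hF.1 (by tauto)
        have ih1 := ih (D.agreeing e F₁ hF₁) (insert e B) hBU' fun F hF => by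
          rw [mem_agreeing] at hF
          exact hin F hF.1 (by tauto)
        -- Feasible sets differ only inside `insert e U`, where `e` is largest.
        have hnot : ∀ F ∈ D.feasible, ¬ D.IsActive F e := by
          have hle : ∀ F ∈ D.feasible, ∀ G ∈ D.feasible, ∀ v ∈ symmDiff F G, v ≤ e := by
            intro F hF G hG v hv
            have hvU : v ∈ insert e U := by
              by_contra hvU
              have h : v ∈ F \ insert e U ↔ v ∈ G \ insert e U := by rw [hB F hF, hB G hG]
              rw [Finset.mem_symmDiff] at hv
              simp only [Finset.mem_sdiff] at h
              tauto
            rcases Finset.mem_insert.1 hvU with rfl | h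
            · exact le_rfl
            · exact (hU v h).le
          intro F hF
          by_cases he : e ∈ F
          · exact D.not_isActive_of_forall_symmDiff_le hF hF₀
              (Finset.mem_symmDiff.2 (Or.inl ⟨he, he₀⟩)) (hle F hF F₀ hF₀)
          · exact D.not_isActive_of_forall_symmDiff_le hF hF₁
              (Finset.mem_symmDiff.2 (Or.inr ⟨he₁, he⟩)) (hle F hF F₁ hF₁)
        have hl0 : ∑ S ∈ U.powerset, weight w x (B ∪ S) * t ^ D.dist (B ∪ S) =
            ∑ F ∈ D.feasible with e ∉ F, D.activityTerm w x t (insert e U) F := by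
          have hD : (D.agreeing e F₀ hF₀).feasible = D.feasible.filter fun F => e ∉ F := by
            ext F; simp [mem_agreeing, he₀]
          rw [← hD]
          refine Eq.trans (Finset.sum_congr rfl fun S hS => ?_)
            (ih0.trans (Finset.sum_congr rfl fun F hF => ?_))
          · rw [D.dist_agreeing hF₀]
            exact iff_of_false (heS S hS) he₀
          · rw [mem_agreeing] at hF
            rw [D.activityTerm_agreeing w x t hF.2 hU,
              D.activityTerm_insert_of_not_isActive w x t heU (hnot F hF.1)]
        have hl1 : ∑ S ∈ U.powerset,
              weight w x (insert e (B ∪ S)) * t ^ D.dist (insert e (B ∪ S)) =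
            ∑ F ∈ D.feasible with e ∈ F, D.activityTerm w x t (insert e U) F := by
          have hD : (D.agreeing e F₁ hF₁).feasible = D.feasible.filter fun F => e ∈ F := by
            ext F; simp [mem_agreeing, he₁]
          rw [← hD]
          refine Eq.trans (Finset.sum_congr rfl fun S hS => ?_)
            (ih1.trans (Finset.sum_congr rfl fun F hF => ?_))
          · rw [Finset.insert_union, D.dist_agreeing hF₁]
            exact iff_of_true (Finset.mem_insert_self _ _) he₁
          · rw [mem_agreeing] at hF
            rw [D.activityTerm_agreeing w x t hF.2 hU,
              D.activityTerm_insert_of_not_isActive w x t heU (hnot F hF.1)]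
        rw [hl0, hl1, add_comm, Finset.sum_filter_add_sum_filter_not]
      · push Not at h0
        -- `D` itself is kept; only `e` moves into the frozen part.
        have ih1 := ih D (insert e B) hBU' fun F hF => hin F hF (h0 F hF)
        have hr : ∀ F ∈ D.feasible, D.activityTerm w x t (insert e U) F =
            (1 + ((w / x : Rˣ) : R) * t) * D.activityTerm w x t U F := by
          intro F hF
          rw [D.activityTerm_insert_of_isActive w x t heU
            (D.isActive_of_forall_agree fun G hG => iff_of_true (h0 G hG) (h0 F hF)),
            toggle, if_pos (h0 F hF)]
        rw [Finset.sum_congr rfl hr, ← Finset.mul_sum, ← ih1, Finset.mul_sum,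
          ← Finset.sum_add_distrib]
        refine Finset.sum_congr rfl fun S hS => ?_
        have hd : D.dist (B ∪ S) = D.dist (insert e (B ∪ S)) + 1 := by
          refine D.dist_eq_succ_of_forall_mem_symmDiff (e := e) ?_ fun F hF =>
            Finset.mem_symmDiff.2 (Or.inl ⟨h0 F hF, heS S hS⟩)
          ext z
          have := heS S hS
          by_cases hz : z = e
          · subst hz; simpa [Finset.mem_symmDiff] using this
          · simp [Finset.mem_symmDiff, hz]
        rw [Finset.insert_union, hd, weight_eq_mul_weight_insert w x (heS S hS)]
        ring
    · push Not at h1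
      have ih0 := ih D B hBU fun F hF => hout F hF (h1 F hF)
      have hr : ∀ F ∈ D.feasible, D.activityTerm w x t (insert e U) F =
          (1 + ((x / w : Rˣ) : R) * t) * D.activityTerm w x t U F := by
        intro F hF
        rw [D.activityTerm_insert_of_isActive w x t heU
          (D.isActive_of_forall_agree fun G hG => iff_of_false (h1 G hG) (h1 F hF)),
          toggle, if_neg (h1 F hF)]
      rw [Finset.sum_congr rfl hr, ← Finset.mul_sum, ← ih0, Finset.mul_sum,
        ← Finset.sum_add_distrib]
      refine Finset.sum_congr rfl fun S hS => ?_
      have hd : D.dist (insert e (B ∪ S)) = D.dist (B ∪ S) + 1 := by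
        refine D.dist_eq_succ_of_forall_mem_symmDiff (e := e) ?_ fun F hF =>
          Finset.mem_symmDiff.2 (Or.inr ⟨Finset.mem_insert_self _ _, h1 F hF⟩)
        ext z
        have := heS S hS
        by_cases hz : z = e
        · subst hz; simpa [Finset.mem_symmDiff] using this
        · simp [Finset.mem_symmDiff, hz]
      rw [hd, weight_insert w x (heS S hS)]
      ring

theorem activityTerm_univ [Fintype E] (F : Finset E) :
    D.activityTerm w x t Finset.univ F =
      (w : R) ^ (Fintype.card E - F.card) * (x : R) ^ F.card *
        (1 + ((w / x : Rˣ) : R) * t) ^ (D.internallyActive F).card *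
        (1 + ((x / w : Rˣ) : R) * t) ^ (D.externallyActive F).card := by
  classical
  rw [activityTerm, weight, mul_assoc _ (_ ^ (D.internallyActive F).card)]
  congr 1
  rw [← Finset.prod_const, ← Finset.prod_const, internallyActive, externallyActive,
    Finset.prod_filter, Finset.prod_filter, ← Finset.prod_mul_distrib]
  refine Finset.prod_congr rfl fun e _ => ?_
  by_cases h : D.IsActive F e <;> by_cases he : e ∈ F <;> simp [h, he, toggle]

end Expansion

end DeltaMatroid

/-- The activities expansion of the transition polynomial of a delta-matroid, evaluated at any
units `w`, `x` and any element `t` of a commutative ring `R`; with `R` the field of rational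
functions over `ℤ` in the indeterminates `w`, `x`, `t` it is the formal identity. -/
theorem mainTheorem5 {E : Type*} [Fintype E] [LinearOrder E] (D : DeltaMatroid E)
    {R : Type*} [CommRing R] (w x : Rˣ) (t : R) :
    MvPolynomial.aeval ![(w : R), (x : R), t] D.transitionPolynomial =
      ∑ F ∈ D.feasible,
        (w : R) ^ (Fintype.card E - F.card) * (x : R) ^ F.card *
          (1 + ((w / x : Rˣ) : R) * t) ^ (D.internallyActive F).card *
          (1 + ((x / w : Rˣ) : R) * t) ^ (D.externallyActive F).card := by
  -- With `U` everything, the freezing condition is vacuous.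
  have h := DeltaMatroid.sum_powerset_eq_sum_activityTerm w x t Finset.univ D ∅
    (Finset.disjoint_empty_left _) fun F _ => by simp
  simp only [Finset.empty_union, Finset.powerset_univ, DeltaMatroid.activityTerm_univ] at h
  rw [← h, DeltaMatroid.transitionPolynomial, map_sum]
  refine Finset.sum_congr rfl fun A _ => ?_
  simp [DeltaMatroid.weight, Finset.card_compl]
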